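/- Let $K$ be a number field of degree $d$ over $\mathbb{Q}$ with ring of integers $\mathcal{O}_K$, fix a $\mathbb{Z}$-basis $e_1,\ldots,e_d$ of $\mathcal{O}_K$, let $K_\mathbb{R}:=K\otimes_\mathbb{Q}\mathbb{R}\cong\mathbb{R}^d$ and let $n\ge 0$ be an integer. For $L>0$ write $$B(L):=\{l_1e_1+\cdots+l_de_d : l_i\in\mathbb{Z},\ |l_i|<L \text{ for all } i\}\subset\mathcal{O}_K.$$ An \emph{$\mathcal{O}_K$-lattice} in $K^n$ is an $\mathcal{O}_K$-submodule $\Gamma\subseteq K^n$ that is discrete in $K_\mathbb{R}^n\cong\mathbb{R}^{nd}$; it has \emph{full rank} if its $K$-span is $K^n$. A \emph{convex body} in $K_\mathbb{R}^n$ is a convex, open, non-empty and bounded subset. For a real number $r\ge 1$, a set $B\subseteq K_\mathbb{R}^n$ is \emph{$r$-thick} if $e_i\cdot B\subseteq r\cdot B$ for all $1\le i\le d$. For every real number $r\ge 1$ there are integers $D_1,D_2>0$, depending only on $K$, $e_1,\ldots,e_d$, $n$ and $r$, such that the following holds. Let $\Gamma\subseteq K^n$ be an $\mathcal{O}_K$-lattice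 of full rank and let $B\subset K_\mathbb{R}^n$ be an $r$-thick centrally symmetric convex body. Then there exist $v_1,\ldots,v_n\in K^n$ and positive integers $L_1,\ldots,L_n$ such that the $\mathcal{O}_K$-GAPs $$P_1:=\{l_1v_1+\cdots+l_nv_n : l_j\in B(L_j)\text{ for all } j\},\qquad P_2:=\{l_1v_1+\cdots+l_nv_n : l_j\in B(D_1L_j)\text{ for all } j\}$$ satisfy $$P_1\subseteq B\cap\Gamma\subseteq \tfrac{1}{D_2}\cdot P_2.$$ -/

import Mathlib

open scoped TensorProduct Pointwise NumberField

noncomputable section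

namespace OKGeom

variable (K : Type*) [Field K] [NumberField K]

/-- `K_ℝ = K ⊗_ℚ ℝ` as an `ℝ`-algebra (scalars written on the left). -/
abbrev KR : Type _ := ℝ ⊗[ℚ] K

variable {K}

/-- The inclusion `K^n → K_ℝ^n`, coordinatewise `a ↦ 1 ⊗ a`. -/
def embed {n : ℕ} (x : Fin n → K) : Fin n → KR K :=
  fun j => (1 : ℝ) ⊗ₜ[ℚ] x j

variable {d : ℕ} (e : Module.Basis (Fin d) ℤ (𝓞 K))

/-- The `ℝ`-basis `1 ⊗ e_1, …, 1 ⊗ e_d` of `K_ℝ` given by a `ℤ`-basis of `𝓞 K`. -/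
def basisKR : Module.Basis (Fin d) ℝ (KR K) :=
  Algebra.TensorProduct.basis ℝ (e.localizationLocalization ℚ (nonZeroDivisors ℤ) K)

/-- The identification `K_ℝ^n ≃ ℝ^{nd}` by coordinates in the basis `1 ⊗ e_i`; it carries the
topology and the bounded sets of the finite-dimensional real vector space `K_ℝ^n`. -/
def coords (n : ℕ) : (Fin n → KR K) ≃ₗ[ℝ] (Fin n → Fin d → ℝ) :=
  LinearEquiv.piCongrRight fun _ => (basisKR e).equivFun

/-- The open ball `B(L)` in `𝓞 K` for the norm `‖∑ l_i e_i‖ = max |l_i|`. -/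
def ball (L : ℕ) : Set (𝓞 K) := {x | ∀ i, |e.repr x i| < (L : ℤ)}

/-- The `𝓞 K`-GAP `{v₀ + l_1 v_1 + ⋯ + l_m v_m : l_j ∈ B(L_j)}` in a `𝓞 K`-module. -/
def gap {V : Type*} [AddCommGroup V] [Module (𝓞 K) V] {m : ℕ}
    (v₀ : V) (v : Fin m → V) (L : Fin m → ℕ) : Set V :=
  {x | ∃ l : Fin m → 𝓞 K, (∀ j, l j ∈ ball e (L j)) ∧ x = v₀ + ∑ j, l j • v j}

/-- An `𝓞 K`-submodule of `K^n` is an `𝓞 K`-lattice if it is discrete in `K_ℝ^n ≃ ℝ^{nd}`. -/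
def IsOKLattice {n : ℕ} (Γ : Submodule (𝓞 K) (Fin n → K)) : Prop :=
  DiscreteTopology ((fun x => coords e n (embed x)) '' (Γ : Set (Fin n → K)))

/-- The `K`-span of `Γ` is all of `K^n`, i.e. the `𝓞 K`-rank of `Γ` is `n`. -/
def IsFullRank {n : ℕ} (Γ : Submodule (𝓞 K) (Fin n → K)) : Prop :=
  Submodule.span K (Γ : Set (Fin n → K)) = ⊤

/-- Centrally symmetric convex bodies in `K_ℝ^n`; a convex body is convex, open, non-empty and
bounded. -/
structure IsSymmConvexBody {n : ℕ} (B : Set (Fin n → KR K)) : Prop where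
  convex : Convex ℝ B
  isOpen : IsOpen (coords e n '' B)
  nonempty : B.Nonempty
  bounded : Bornology.IsBounded (coords e n '' B)
  symm : ∀ x ∈ B, -x ∈ B

/-- `B ⊆ K_ℝ^n` is `r`-thick if `e_i · B ⊆ r · B` for all `i`. -/
def IsThick {n : ℕ} (r : ℝ) (B : Set (Fin n → KR K)) : Prop :=
  ∀ i, ((1 : ℝ) ⊗ₜ[ℚ] ((e i : 𝓞 K) : K) : KR K) • B ⊆ r • B

end OKGeom

end

/-! The gauge of `B` restricts to a norm on `K^n` for which multiplication by `a` increases lengths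
by at most a constant times `‖a‖`. Choose `v₁, …, vₙ ∈ Γ` as successively shortest `K`-independent
vectors and `L_j` of order `1 / ‖v_j‖`, so that `P₁` lies in the unit ball `B`. If `x ∈ Γ` is
supported on `v₁, …, v_k`, then Dirichlet's theorem gives a multiple `q • x`, with `q` bounded,
within distance `‖v_k‖ / 2` of an `𝓞 K`-combination of `v₁, …, v_k`. By minimality of `v_k` the
difference is supported on `v₁, …, v_{k-1}`, so by induction the coordinates of `x` have bounded
denominators. If `x`, in `Γ` or not, is much shorter than `v_k`, then that combination is also
shorter than `v_k`, and its `k`-th coefficient vanishes; by scaling, this bounds the `k`-th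
coordinate of any `x ∈ K^n` supported on `v₁, …, v_k` by a multiple of `‖x‖ / ‖v_k‖`. -/

namespace OKGeom

open Module Set

section Dirichlet

theorem exists_nat_mul_sub_int_lt {F ι : Type*} [Field F] [LinearOrder F] [IsStrictOrderedRing F]
    [FloorRing F] [Fintype ι] {m : ℕ} (hm : 0 < m) (y : ι → F) :
    ∃ q : ℕ, 0 < q ∧ q ≤ m ^ Fintype.card ι ∧ ∃ z : ι → ℤ, ∀ i, |q * y i - z i| < 1 / (m : F) := by
  classical
  have hm' : (0 : F) < m := Nat.cast_pos.2 hm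
  let box (k : ℕ) (i : ι) : ℤ := ⌊(m : F) * Int.fract (k * y i)⌋
  have hbox : MapsTo box (Finset.range (m ^ Fintype.card ι + 1))
      (Fintype.piFinset fun _ : ι => Finset.Ico (0 : ℤ) m) := fun k _ => by
    simp only [Finset.mem_coe, Fintype.mem_piFinset, Finset.mem_Ico]
    exact fun i => ⟨Int.floor_nonneg.2 (mul_nonneg hm'.le (Int.fract_nonneg _)),
      Int.floor_lt.2 (by simpa using mul_lt_mul_of_pos_left (Int.fract_lt_one (k * y i)) hm')⟩
  obtain ⟨k, hk, k', hk', hne, heq⟩ :=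
    Finset.exists_ne_map_eq_of_card_lt_of_maps_to (by simp) hbox
  wlog hlt : k' < k generalizing k k'
  · exact this k' hk' k hk hne.symm heq.symm (hne.lt_or_gt.resolve_right hlt)
  rw [Finset.mem_range] at hk
  refine ⟨k - k', by omega, by omega, fun i => ⌊k * y i⌋ - ⌊k' * y i⌋, fun i => ?_⟩
  have hfract : ((k - k' : ℕ) : F) * y i - ((⌊k * y i⌋ - ⌊k' * y i⌋ : ℤ) : F) =
      Int.fract (k * y i) - Int.fract (k' * y i) := by
    rw [Nat.cast_sub hlt.le, Int.cast_sub]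
    simp only [Int.fract]
    ring
  have hclose := Int.abs_sub_lt_one_of_floor_eq_floor (congrFun heq i)
  rw [← mul_sub, abs_mul, abs_of_pos hm'] at hclose
  rwa [hfract, lt_div_iff₀' hm']

end Dirichlet

section SuccessiveMinima

variable {K V α : Type*} [DivisionRing K] [AddCommGroup V] [Module K V] [LinearOrder α]

/-- The `K`-basis `b` realises the successive minima of the length function `p` on the set `S`:
each `b k` lies in `S` and is shortest among the elements of `S` outside the `K`-span of the
previous basis vectors. -/
structure IsSuccessiveMinima {n : ℕ} (S : Set V) (p : V → α) (b : Basis (Fin n) K V) : Prop where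
  mem : ∀ k, b k ∈ S
  le_of_notMem_span : ∀ k, ∀ x ∈ S, x ∉ Submodule.span K (b '' Iio k) → p (b k) ≤ p x

namespace IsSuccessiveMinima

variable {n : ℕ} {S : Set V} {p : V → α} {b : Basis (Fin n) K V} (hb : IsSuccessiveMinima S p b)
include hb

theorem repr_eq_zero_of_lt {x : V} {j k : Fin n} (hxS : x ∈ S) (hx : p x < p (b k))
    (hkj : k ≤ j) : b.repr x j = 0 := by
  have hspan : x ∈ Submodule.span K (b '' Iio k) := by
    contrapose! hx
    exact hb.le_of_notMem_span k x hxS hx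
  by_contra hne
  exact hkj.not_gt (b.mem_span_image.1 hspan (Finsupp.mem_support_iff.2 hne))

theorem monotone : Monotone fun k => p (b k) := fun j k hjk => by
  by_contra! hlt
  simpa using hb.repr_eq_zero_of_lt (hb.mem k) hlt hjk

end IsSuccessiveMinima

theorem exists_isLeast_notMem {S : Set V} {p : V → α} (hspan : Submodule.span K S = ⊤)
    (hfin : ∀ R, {x | x ∈ S ∧ p x ≤ R}.Finite) {U : Submodule K V} (hU : U ≠ ⊤) :
    ∃ w ∈ S, w ∉ U ∧ ∀ x ∈ S, x ∉ U → p w ≤ p x := by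
  obtain ⟨y, hyS, hyU⟩ : ∃ y ∈ S, y ∉ U := by
    by_contra! hSU
    exact hU (top_le_iff.1 (hspan ▸ Submodule.span_le.2 hSU))
  obtain ⟨w, ⟨⟨hwS, hwy⟩, hwU⟩, hmin⟩ := exists_min_image ({x | x ∈ S ∧ p x ≤ p y} \ U) p
    ((hfin (p y)).subset sdiff_subset) ⟨y, ⟨hyS, le_rfl⟩, hyU⟩
  refine ⟨w, hwS, hwU, fun x hxS hxU => ?_⟩
  rcases le_total (p x) (p y) with hxy | hyx
  · exact hmin x ⟨⟨hxS, hxy⟩, hxU⟩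
  · exact hwy.trans hyx

theorem exists_forall_eq_apply_span_image_Iio (F : Submodule K V → V) :
    ∃ v : ℕ → V, ∀ k, v k = F (Submodule.span K (v '' Iio k)) := by
  let U : ℕ → Submodule K V := fun k => Nat.rec ⊥ (fun _ U => U ⊔ Submodule.span K {F U}) k
  have hU : ∀ k, U k = Submodule.span K ((fun i => F (U i)) '' Iio k) := fun k => by
    induction k with
    | zero => simp [U]
    | succ k ih =>
      rw [← Order.succ_eq_add_one, Order.Iio_succ_eq_insert, image_insert_eq,
        Submodule.span_insert, ← ih, sup_comm]
      rfl
  exact ⟨fun k => F (U k), fun k => congrArg F (hU k)⟩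

theorem span_image_Iio_ne_top [FiniteDimensional K V] (v : ℕ → V) {k : ℕ} (hk : k < finrank K V) :
    Submodule.span K (v '' Iio k) ≠ ⊤ := fun htop => by
  have hle := finrank_range_le_card (R := K) fun i : Iio k => v i
  rw [← image_eq_range, Set.finrank, htop, finrank_top] at hle
  simp at hle
  omega

theorem linearIndepOn_Iio {v : ℕ → V} {n : ℕ}
    (hv : ∀ k < n, v k ∉ Submodule.span K (v '' Iio k)) : LinearIndepOn K v (Iio n) := by
  induction n with
  | zero => simp
  | succ n ih =>
    rw [← Order.succ_eq_add_one, Order.Iio_succ_eq_insert]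
    exact (ih fun k hk => hv k (by omega)).insert (hv n n.lt_succ_self)

theorem exists_isSuccessiveMinima [FiniteDimensional K V] {n : ℕ} (hn : finrank K V = n)
    {S : Set V} {p : V → α} (hspan : Submodule.span K S = ⊤)
    (hfin : ∀ R, {x | x ∈ S ∧ p x ≤ R}.Finite) :
    ∃ b : Basis (Fin n) K V, IsSuccessiveMinima S p b := by
  choose! F hFS hFU hFmin using fun U : Submodule K V => exists_isLeast_notMem hspan hfin (U := U)
  obtain ⟨v, hv⟩ := exists_forall_eq_apply_span_image_Iio F
  have hne : ∀ k < n, Submodule.span K (v '' Iio k) ≠ ⊤ := fun k hk =>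
    span_image_Iio_ne_top v (hn ▸ hk)
  have hindep : LinearIndependent K fun i : Fin n => v i :=
    (linearIndepOn_Iio fun k hk => hv k ▸ hFU _ (hne k hk)).comp
      (fun i : Fin n => (⟨i, i.2⟩ : Iio n)) fun i j hij => Fin.ext (congrArg Subtype.val hij)
  let b := Basis.mk hindep (hindep.span_eq_top_of_card_eq_finrank' (by simp [hn])).ge
  have hb : ⇑b = v ∘ Fin.val := Basis.coe_mk _ _
  have himage : ∀ k : Fin n, b '' Iio k = v '' Iio (k : ℕ) := fun k => by
    rw [hb, image_comp, Fin.image_val_Iio]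
  refine ⟨b, fun k => ?_, fun k => ?_⟩
  · rw [hb, Function.comp_apply, hv]
    exact hFS _ (hne k k.2)
  · rw [himage, hb, Function.comp_apply, hv]
    exact hFmin _ (hne k k.2)

end SuccessiveMinima

section Approximation

variable {K : Type*} [Field K] [NumberField K] {d : ℕ} (e : Basis (Fin d) ℤ (𝓞 K))

/-- The `ℚ`-basis of `K` given by a `ℤ`-basis of `𝓞 K`. -/
noncomputable def ratBasis : Basis (Fin d) ℚ K :=
  e.localizationLocalization ℚ (nonZeroDivisors ℤ) K

theorem ratBasis_apply (i : Fin d) : ratBasis e i = e i :=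
  Basis.localizationLocalization_apply ℚ (nonZeroDivisors ℤ) K e i

theorem ratBasis_equivFun_coe (x : 𝓞 K) (i : Fin d) :
    (ratBasis e).equivFun (x : K) i = e.repr x i :=
  Basis.localizationLocalization_repr_algebraMap ℚ (nonZeroDivisors ℤ) K e x i

/-- The norm `‖∑ tᵢ eᵢ‖ = max |tᵢ|` on `K`, whose open ball of radius `L` meets `𝓞 K` in the
set `B(L)`. -/
noncomputable def basisNorm : Seminorm ℚ K :=
  (normSeminorm ℚ (Fin d → ℚ)).comp (ratBasis e).equivFun.toLinearMap

theorem basisNorm_apply (a : K) : basisNorm e a = ‖(ratBasis e).equivFun a‖ := rfl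

variable {e}

theorem mem_ball_iff_basisNorm_lt {L : ℕ} (hL : 0 < L) {x : 𝓞 K} :
    x ∈ ball e L ↔ basisNorm e x < L := by
  rw [basisNorm_apply, pi_norm_lt_iff (Nat.cast_pos.2 hL)]
  simp only [ratBasis_equivFun_coe, Int.norm_cast_rat, Int.norm_eq_abs]
  exact forall_congr' fun i => by norm_cast

theorem basisNorm_le_sub_one_of_mem_ball {L : ℕ} (hL : 0 < L) {x : 𝓞 K} (hx : x ∈ ball e L) :
    basisNorm e x ≤ L - 1 := by
  rw [basisNorm_apply, pi_norm_le_iff_of_nonneg (sub_nonneg.2 (Nat.one_le_cast.2 hL))]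
  intro i
  rw [ratBasis_equivFun_coe, Int.norm_cast_rat, Int.norm_eq_abs]
  exact_mod_cast Int.le_sub_one_of_lt (hx i)

omit [NumberField K] in
theorem eq_zero_of_mem_ball_one {x : 𝓞 K} (hx : x ∈ ball e 1) : x = 0 :=
  e.repr.map_eq_zero_iff.1 (Finsupp.ext fun i => Int.abs_lt_one_iff.1 (hx i))

variable (e) in
theorem exists_basisNorm_nsmul_sub_lt {ι : Type*} [Fintype ι] {m : ℕ} (hm : 0 < m) (a : ι → K) :
    ∃ q : ℕ, 0 < q ∧ q ≤ m ^ (Fintype.card ι * d) ∧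
      ∃ l : ι → 𝓞 K, ∀ j, basisNorm e (q • a j - l j) < 1 / m := by
  obtain ⟨q, hq, hqm, z, hz⟩ := exists_nat_mul_sub_int_lt hm
    fun t : ι × Fin d => (ratBasis e).equivFun (a t.1) t.2
  refine ⟨q, hq, by simpa using hqm, fun j => e.equivFun.symm fun i => z (j, i), fun j => ?_⟩
  rw [basisNorm_apply, pi_norm_lt_iff (by positivity)]
  intro i
  have hcoord : (ratBasis e).equivFun (q • a j - (e.equivFun.symm fun i => z (j, i) : 𝓞 K)) i =
      q * (ratBasis e).equivFun (a j) i - z (j, i) := by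
    rw [map_sub, map_nsmul, Pi.sub_apply, ratBasis_equivFun_coe, ← Basis.equivFun_apply,
      LinearEquiv.apply_symm_apply, Pi.smul_apply, nsmul_eq_mul]
  rw [hcoord, ← Rat.norm_cast_real, Real.norm_eq_abs, ← Rat.cast_abs]
  simpa using (Rat.cast_lt (K := ℝ)).2 (hz (j, i))

end Approximation

section ThickSeminorm

variable {K : Type*} [Field K] [NumberField K] {d : ℕ} {e : Basis (Fin d) ℤ (𝓞 K)}
  {V : Type*} [AddCommGroup V] [Module K V] [Module ℚ V] {c : ℝ} {p : Seminorm ℚ V}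

/-- The analogue of thickness for a seminorm on a `K`-vector space: multiplication by `a`
increases lengths by a factor of at most `c * ‖a‖`. A body that is `r`-thick in the sense of
`IsThick` gives a seminorm that is `d * r`-thick in this sense. -/
structure IsThickSeminorm (e : Basis (Fin d) ℤ (𝓞 K)) (c : ℝ) (p : Seminorm ℚ V) : Prop where
  nonneg : 0 ≤ c
  smul_le : ∀ (a : K) (x : V), p (a • x) ≤ c * basisNorm e a * p x

theorem seminorm_sum_le {ι : Type*} (p : Seminorm ℚ V) (s : Finset ι) (f : ι → V) :
    p (∑ i ∈ s, f i) ≤ ∑ i ∈ s, p (f i) :=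
  Finset.le_sum_of_subadditive p (map_zero p).le (map_add_le_add p) s f

theorem seminorm_nsmul (p : Seminorm ℚ V) (q : ℕ) (x : V) : p (q • x) = q * p x := by
  rw [← Nat.cast_smul_eq_nsmul ℚ, map_smul_eq_mul, ← Rat.norm_cast_real, Rat.cast_natCast,
    Real.norm_natCast]

theorem isThickSeminorm_of_basis {r : ℝ} (hr : 0 ≤ r)
    (h : ∀ i x, p ((e i : K) • x) ≤ r * p x) : IsThickSeminorm e (d * r) p where
  nonneg := by positivity
  smul_le a x := by
    set t := (ratBasis e).equivFun a
    have hexpand : a • x = ∑ i, t i • (e i : K) • x := by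
      conv_lhs => rw [← (ratBasis e).sum_equivFun a, Finset.sum_smul]
      exact Finset.sum_congr rfl fun i _ => by rw [ratBasis_apply, smul_assoc]
    calc p (a • x) ≤ ∑ i, p (t i • (e i : K) • x) := hexpand ▸ seminorm_sum_le p _ _
      _ ≤ ∑ _i : Fin d, basisNorm e a * (r * p x) := by
        gcongr with i
        rw [map_smul_eq_mul]
        gcongr
        · exact norm_le_pi_norm t i
        · exact h i x
      _ = d * r * basisNorm e a * p x := by
        rw [Finset.sum_const, Finset.card_univ, Fintype.card_fin, nsmul_eq_mul]
        ring

omit [NumberField K] [Module ℚ V] in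
theorem repr_sum_integer_smul [Module (𝓞 K) V] [IsScalarTower (𝓞 K) K V] {n : ℕ}
    (b : Basis (Fin n) K V) (l : Fin n → 𝓞 K) (j : Fin n) :
    b.repr (∑ j, l j • b j) j = l j := by
  have hsum : ∑ j, l j • b j = ∑ j, (l j : K) • b j :=
    Finset.sum_congr rfl fun j _ => (algebraMap_smul K (l j) (b j)).symm
  rw [hsum, b.repr_sum_self]

/-- Dirichlet's bound for the denominator in the simultaneous approximation of `n` elements of `K`,
with the error so small that it at least halves lengths under a `c`-thick seminorm. -/
noncomputable def denomBound (n d : ℕ) (c : ℝ) : ℕ := (⌈2 * n * c⌉₊ + 1) ^ (n * d)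

namespace IsThickSeminorm

variable {n : ℕ} {b : Basis (Fin n) K V} (hp : IsThickSeminorm e c p)
include hp

theorem le_of_basisNorm_repr_le {x : V} {k : Fin n} {ε : ℝ} (hmono : Monotone fun j => p (b j))
    (hx : ∀ j, k < j → b.repr x j = 0) (hε : ∀ j, basisNorm e (b.repr x j) ≤ ε) :
    p x ≤ n * c * ε * p (b k) := by
  have hc := hp.nonneg
  have hε0 : 0 ≤ ε := (apply_nonneg _ _).trans (hε k)
  have hterm : ∀ j, p (b.repr x j • b j) ≤ c * ε * p (b k) := fun j => by
    rcases le_or_gt j k with hjk | hkj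
    · refine (hp.smul_le _ _).trans ?_
      gcongr
      · exact hε j
      · exact hmono hjk
    · rw [hx j hkj, zero_smul, map_zero]
      positivity
  calc p x = p (∑ j, b.repr x j • b j) := by rw [b.sum_repr]
    _ ≤ ∑ _j : Fin n, c * ε * p (b k) :=
      (seminorm_sum_le p _ _).trans (Finset.sum_le_sum fun j _ => hterm j)
    _ = n * c * ε * p (b k) := by
      rw [Finset.sum_const, Finset.card_univ, Fintype.card_fin, nsmul_eq_mul]
      ring

variable [Module (𝓞 K) V] [IsScalarTower (𝓞 K) K V]

theorem exists_nsmul_sub_sum_le_half {x : V} {k : Fin n} (hmono : Monotone fun j => p (b j))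
    (hx : ∀ j, k < j → b.repr x j = 0) :
    ∃ q : ℕ, 0 < q ∧ q ≤ denomBound n d c ∧ ∃ l : Fin n → 𝓞 K,
      (∀ j, basisNorm e (q • b.repr x j - l j) < 1) ∧
        p (q • x - ∑ j, l j • b j) ≤ p (b k) / 2 := by
  set m : ℕ := ⌈2 * n * c⌉₊ + 1 with hm
  have hm1 : (1 : ℝ) ≤ m := by simp [hm]
  have hmc : 2 * n * c / m ≤ 1 := by
    rw [div_le_one (by positivity), hm, Nat.cast_add_one]
    exact (Nat.le_ceil _).trans (le_add_of_nonneg_right zero_le_one)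
  obtain ⟨q, hq, hqm, l, hl⟩ :=
    exists_basisNorm_nsmul_sub_lt e (Nat.succ_pos _ : 0 < m) fun j => b.repr x j
  have hl1 : ∀ j, basisNorm e (q • b.repr x j - l j) < 1 := fun j =>
    (hl j).trans_le ((div_le_one (by positivity)).2 hm1)
  have hrepr : ∀ j, b.repr (q • x - ∑ i, l i • b i) j = q • b.repr x j - l j := fun j => by
    rw [map_sub, map_nsmul, Finsupp.sub_apply, Finsupp.smul_apply, repr_sum_integer_smul]
  have hvanish : ∀ j, k < j → b.repr (q • x - ∑ i, l i • b i) j = 0 := fun j hkj => by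
    have hlj : l j ∈ ball e 1 := (mem_ball_iff_basisNorm_lt one_pos).2 <| by
      simpa [hx j hkj] using hl1 j
    rw [hrepr, hx j hkj, eq_zero_of_mem_ball_one hlj]
    simp
  refine ⟨q, hq, by simpa [denomBound] using hqm, l, hl1, ?_⟩
  calc p (q • x - ∑ j, l j • b j) ≤ n * c * (1 / m) * p (b k) :=
        hp.le_of_basisNorm_repr_le hmono hvanish fun j => hrepr j ▸ (hl j).le
    _ = 2 * n * c / m * (p (b k) / 2) := by ring
    _ ≤ p (b k) / 2 := mul_le_of_le_one_left (by positivity) hmc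

end IsThickSeminorm

end ThickSeminorm

section Coordinates

variable {K : Type*} [Field K] [NumberField K] {d : ℕ} {e : Basis (Fin d) ℤ (𝓞 K)}
  {V : Type*} [AddCommGroup V] [Module K V] [Module ℚ V] [Module (𝓞 K) V]
  [IsScalarTower (𝓞 K) K V] {c : ℝ} {p : Seminorm ℚ V} {n : ℕ} {b : Basis (Fin n) K V}
  {Γ : Submodule (𝓞 K) V}

namespace IsSuccessiveMinima

variable (hb : IsSuccessiveMinima (Γ : Set V) p b) (hp : IsThickSeminorm e c p)
include hb

omit [NumberField K] [IsScalarTower (𝓞 K) K V] in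
theorem sum_smul_mem (l : Fin n → 𝓞 K) : ∑ j, l j • b j ∈ Γ :=
  Γ.sum_mem fun j _ => Γ.smul_mem _ (hb.mem j)

include hp

theorem isIntegral_factorial_pow_smul_repr_of_support (hpos : ∀ j, 0 < p (b j)) {k : ℕ}
    (hkn : k ≤ n) {x : V} (hxΓ : x ∈ Γ) (hx : ∀ j : Fin n, k ≤ j → b.repr x j = 0) (j : Fin n) :
    IsIntegral ℤ (((denomBound n d c).factorial ^ k) • b.repr x j) := by
  induction k generalizing x with
  | zero => simpa [hx j (Nat.zero_le _)] using isIntegral_zero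
  | succ k ih =>
    obtain ⟨q, hq, hqQ, l, -, hhalf⟩ := hp.exists_nsmul_sub_sum_le_half (k := ⟨k, hkn⟩)
      hb.monotone fun j hj => hx j (Nat.succ_le_of_lt hj)
    set y : V := q • x - ∑ j, l j • b j with hy
    have hyΓ : y ∈ Γ := Γ.sub_mem (Γ.nsmul_mem hxΓ q) (hb.sum_smul_mem l)
    have hyint := ih (by omega) hyΓ fun j hkj =>
      hb.repr_eq_zero_of_lt hyΓ (hhalf.trans_lt (half_lt_self (hpos _))) (Fin.mk_le_of_le_val hkj)
    have hyrepr : b.repr y j = q * b.repr x j - l j := by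
      rw [hy, map_sub, map_nsmul, Finsupp.sub_apply, Finsupp.smul_apply,
        repr_sum_integer_smul, nsmul_eq_mul]
    obtain ⟨s, hs⟩ := Nat.dvd_factorial hq hqQ
    have hdecomp : (denomBound n d c).factorial ^ (k + 1) • b.repr x j =
        s • ((denomBound n d c).factorial ^ k • b.repr y j +
          (denomBound n d c).factorial ^ k • (l j : K)) := by
      rw [← smul_add, hyrepr, sub_add_cancel, ← nsmul_eq_mul, smul_smul, smul_smul, pow_succ]
      nth_rw 2 [hs]
      congr 1
      ring
    rw [hdecomp]
    exact (hyint.add ((NumberField.RingOfIntegers.isIntegral_coe (l j)).nsmul _)).nsmul s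

theorem basisNorm_repr_le_one {x : V} {k : Fin n} (hx : ∀ j, k < j → b.repr x j = 0)
    (hxk : 2 * denomBound n d c * p x < p (b k)) : basisNorm e (b.repr x k) ≤ 1 := by
  obtain ⟨q, hq, hqQ, l, hl, hhalf⟩ := hp.exists_nsmul_sub_sum_le_half hb.monotone hx
  have hqx : p (q • x) < p (b k) / 2 := by
    rw [seminorm_nsmul]
    have : (q : ℝ) * p x ≤ denomBound n d c * p x := by gcongr
    linarith
  have hsum : p (∑ j, l j • b j) < p (b k) := by
    have := map_sub_le_add p (q • x) (q • x - ∑ j, l j • b j)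
    rw [sub_sub_cancel] at this
    linarith
  have hlk : (l k : K) = 0 := by
    rw [← repr_sum_integer_smul b]
    exact hb.repr_eq_zero_of_lt (hb.sum_smul_mem l) hsum le_rfl
  have hqk : q * basisNorm e (b.repr x k) < 1 := by
    simpa only [hlk, sub_zero, seminorm_nsmul] using hl k
  exact (le_mul_of_one_le_left (apply_nonneg _ _) (Nat.one_le_cast.2 hq)).trans hqk.le

theorem basisNorm_repr_last_mul_le (hpos : ∀ j, 0 < p (b j)) {x : V} {k : Fin n}
    (hx : ∀ j, k < j → b.repr x j = 0) :
    basisNorm e (b.repr x k) * p (b k) ≤ 2 * denomBound n d c * p x := by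
  rw [← le_div_iff₀ (hpos k)]
  refine le_of_forall_lt_rat_imp_le fun t ht => ?_
  have ht0 : (0 : ℝ) < t := lt_of_le_of_lt (by positivity) ht
  have hnorm : ‖t⁻¹‖ = (t : ℝ)⁻¹ := by
    rw [norm_inv, ← Rat.norm_cast_real, Real.norm_of_nonneg ht0.le]
  have hsmall : 2 * denomBound n d c * p (t⁻¹ • x) < p (b k) := by
    rw [div_lt_iff₀ (hpos k)] at ht
    rwa [map_smul_eq_mul, hnorm, mul_left_comm, inv_mul_lt_iff₀ ht0]
  have hrepr : ∀ j, b.repr (t⁻¹ • x) j = t⁻¹ • b.repr x j := fun j => by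
    rw [map_rat_smul b.repr, Finsupp.smul_apply]
  have hle := hb.basisNorm_repr_le_one hp (x := t⁻¹ • x)
    (fun j hj => by rw [hrepr, hx j hj, smul_zero]) hsmall
  rwa [hrepr, map_smul_eq_mul, hnorm, inv_mul_le_iff₀ ht0, mul_one] at hle

theorem basisNorm_repr_mul_le_of_support (hpos : ∀ j, 0 < p (b j)) {k : ℕ} (hkn : k ≤ n) {x : V}
    (hx : ∀ j : Fin n, k ≤ j → b.repr x j = 0) (j : Fin n) :
    basisNorm e (b.repr x j) * p (b j) ≤
      2 * denomBound n d c * (1 + 2 * denomBound n d c * c) ^ k * p x := by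
  have hc := hp.nonneg
  induction k generalizing x with
  | zero =>
    rw [hx j (Nat.zero_le _), map_zero, zero_mul]
    positivity
  | succ k ih =>
    have hlast := hb.basisNorm_repr_last_mul_le hp hpos (k := ⟨k, hkn⟩)
      (fun j hj => hx j (Nat.succ_le_of_lt hj))
    rcases eq_or_ne j ⟨k, hkn⟩ with rfl | hjk
    · have hbase : 1 ≤ 1 + 2 * denomBound n d c * c := le_add_of_nonneg_right (by positivity)
      exact hlast.trans <| mul_le_mul_of_nonneg_right
        (le_mul_of_one_le_right (by positivity) (one_le_pow₀ hbase)) (apply_nonneg p x)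
    set y : V := x - b.repr x ⟨k, hkn⟩ • b ⟨k, hkn⟩ with hy
    have hyrepr : ∀ i, i ≠ ⟨k, hkn⟩ → b.repr y i = b.repr x i := fun i hi => by
      simp [hy, Finsupp.single_eq_of_ne hi]
    have hysupp : ∀ i : Fin n, k ≤ i → b.repr y i = 0 := fun i hki => by
      rcases eq_or_ne i ⟨k, hkn⟩ with rfl | hik
      · simp [hy]
      · rw [hyrepr i hik]
        exact hx i (lt_of_le_of_ne hki fun h => hik (Fin.ext h.symm))
    have hyle : p y ≤ (1 + 2 * denomBound n d c * c) * p x := by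
      have hsmul := hp.smul_le (b.repr x ⟨k, hkn⟩) (b ⟨k, hkn⟩)
      have hscaled := mul_le_mul_of_nonneg_left hlast hc
      linarith [map_sub_le_add p x (b.repr x ⟨k, hkn⟩ • b ⟨k, hkn⟩)]
    calc basisNorm e (b.repr x j) * p (b j)
        ≤ 2 * denomBound n d c * (1 + 2 * denomBound n d c * c) ^ k * p y :=
          hyrepr j hjk ▸ ih (by omega) hysupp
      _ ≤ 2 * denomBound n d c * (1 + 2 * denomBound n d c * c) ^ k *
            ((1 + 2 * denomBound n d c * c) * p x) := by gcongr
      _ = 2 * denomBound n d c * (1 + 2 * denomBound n d c * c) ^ (k + 1) * p x := by ring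

theorem isIntegral_factorial_pow_smul_repr (hpos : ∀ j, 0 < p (b j)) {x : V} (hxΓ : x ∈ Γ)
    (j : Fin n) : IsIntegral ℤ ((denomBound n d c).factorial ^ n • b.repr x j) :=
  hb.isIntegral_factorial_pow_smul_repr_of_support hp hpos le_rfl hxΓ
    (fun i hi => absurd i.2 (not_lt_of_ge hi)) j

theorem basisNorm_repr_mul_le (hpos : ∀ j, 0 < p (b j)) (x : V) (j : Fin n) :
    basisNorm e (b.repr x j) * p (b j) ≤
      2 * denomBound n d c * (1 + 2 * denomBound n d c * c) ^ n * p x :=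
  hb.basisNorm_repr_mul_le_of_support hp hpos le_rfl
    (fun i hi => absurd i.2 (not_lt_of_ge hi)) j

end IsSuccessiveMinima

end Coordinates

section Gap

theorem seminorm_pos_of_finite {V : Type*} [AddCommGroup V] [Module ℚ V] {p : Seminorm ℚ V}
    {S : AddSubmonoid V} (hfin : {x | x ∈ S ∧ p x ≤ 0}.Finite) {x : V} (hxS : x ∈ S)
    (hx : x ≠ 0) : 0 < p x := by
  by_contra! hpx
  have hinj : Function.Injective fun q : ℕ => q • x := fun q s hqs =>
    Nat.cast_injective (R := ℚ) <| smul_left_injective ℚ hx <| by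
      simpa only [Nat.cast_smul_eq_nsmul ℚ] using hqs
  have hmem : ∀ q : ℕ, q • x ∈ {x | x ∈ S ∧ p x ≤ 0} := fun q => by
    refine ⟨S.nsmul_mem hxS q, ?_⟩
    rw [seminorm_nsmul]
    exact mul_nonpos_of_nonneg_of_nonpos q.cast_nonneg hpx
  exact infinite_of_injective_forall_mem hinj hmem hfin

variable {K : Type*} [Field K] [NumberField K] {d : ℕ} {e : Basis (Fin d) ℤ (𝓞 K)}
  {V : Type*} [AddCommGroup V] [Module K V] [Module ℚ V] [Module (𝓞 K) V]
  [IsScalarTower (𝓞 K) K V] {c : ℝ} {p : Seminorm ℚ V} {n : ℕ}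

theorem IsThickSeminorm.lt_one_of_mem_gap (hp : IsThickSeminorm e c p) {v : Fin n → V}
    {L : Fin n → ℕ} (hL : ∀ j, 0 < L j) (hLv : ∀ j, (L j - 1) * p (v j) ≤ 1 / (n * c + 1))
    {x : V} (hx : x ∈ gap e 0 v L) : p x < 1 := by
  obtain ⟨l, hl, rfl⟩ := hx
  have hc := hp.nonneg
  have hterm : ∀ j, p (l j • v j) ≤ c * (1 / (n * c + 1)) := fun j =>
    calc p (l j • v j) ≤ c * basisNorm e (l j) * p (v j) :=
          algebraMap_smul K (l j) (v j) ▸ hp.smul_le _ _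
      _ ≤ c * (L j - 1) * p (v j) := by
          gcongr
          exact basisNorm_le_sub_one_of_mem_ball (hL j) (hl j)
      _ ≤ c * (1 / (n * c + 1)) := by
          rw [mul_assoc]
          gcongr
          exact hLv j
  calc p (0 + ∑ j, l j • v j) ≤ ∑ _j : Fin n, c * (1 / (n * c + 1)) := by
        rw [zero_add]
        exact (seminorm_sum_le p _ _).trans (Finset.sum_le_sum fun j _ => hterm j)
    _ = n * c / (n * c + 1) := by
        rw [Finset.sum_const, Finset.card_univ, Fintype.card_fin, nsmul_eq_mul]
        ring
    _ < 1 := by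
        rw [div_lt_one (by positivity)]
        exact lt_add_one _

omit [Module ℚ V] in
theorem mem_inv_smul_gap_of_isIntegral {b : Basis (Fin n) K V} {D : ℕ} (hD : 0 < D)
    {L : Fin n → ℕ} (hL : ∀ j, 0 < L j) {x : V} (hint : ∀ j, IsIntegral ℤ (D • b.repr x j))
    (hx : ∀ j, D * basisNorm e (b.repr x j) < L j) : x ∈ (D : K)⁻¹ • gap e 0 b L := by
  have hD' : (D : K) ≠ 0 := Nat.cast_ne_zero.2 hD.ne'
  let l : Fin n → 𝓞 K := fun j => ⟨D • b.repr x j, hint j⟩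
  have hl : ∀ j, (l j : K) = D • b.repr x j := fun _ => rfl
  rw [mem_inv_smul_set_iff₀ hD']
  refine ⟨l, fun j => (mem_ball_iff_basisNorm_lt (hL j)).2 ?_, ?_⟩
  · rw [hl, seminorm_nsmul]
    exact hx j
  · rw [zero_add]
    refine b.repr.injective (Finsupp.ext fun j => ?_)
    rw [repr_sum_integer_smul, map_smul, Finsupp.smul_apply, smul_eq_mul, hl,
      nsmul_eq_mul]

theorem IsSuccessiveMinima.mem_inv_smul_gap {b : Basis (Fin n) K V} {Γ : Submodule (𝓞 K) V}
    (hb : IsSuccessiveMinima (Γ : Set V) p b) (hp : IsThickSeminorm e c p)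
    (hpos : ∀ j, 0 < p (b j)) {L : Fin n → ℕ} (hL : ∀ j, 0 < L j)
    (hLb : ∀ j, (denomBound n d c).factorial ^ n *
      (2 * denomBound n d c * (1 + 2 * denomBound n d c * c) ^ n) < L j * p (b j))
    {x : V} (hxΓ : x ∈ Γ) (hx : p x ≤ 1) :
    x ∈ (((denomBound n d c).factorial ^ n : ℕ) : K)⁻¹ • gap e 0 b L := by
  have hc := hp.nonneg
  refine mem_inv_smul_gap_of_isIntegral (by positivity) hL
    (hb.isIntegral_factorial_pow_smul_repr hp hpos hxΓ) fun j => ?_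
  have hsize := (hb.basisNorm_repr_mul_le hp hpos x j).trans
    (mul_le_of_le_one_right (by positivity) hx)
  refine lt_of_mul_lt_mul_right (lt_of_le_of_lt ?_ (hLb j)) (hpos j).le
  rw [mul_assoc, Nat.cast_pow]
  gcongr

variable (e) in
theorem exists_gap_subset_unitBall_subset_smul_gap (V : Type*) [AddCommGroup V] [Module K V]
    [FiniteDimensional K V] [Module ℚ V] [Module (𝓞 K) V] [IsScalarTower (𝓞 K) K V]
    (hn : finrank K V = n) (hc : 0 ≤ c) :
    ∃ D₁ D₂ : ℕ, 0 < D₁ ∧ 0 < D₂ ∧ ∀ (p : Seminorm ℚ V) (Γ : Submodule (𝓞 K) V),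
      IsThickSeminorm e c p → Submodule.span K (Γ : Set V) = ⊤ →
      (∀ R, {x | x ∈ Γ ∧ p x ≤ R}.Finite) →
      ∃ (v : Fin n → V) (L : Fin n → ℕ), (∀ j, 0 < L j) ∧
        gap e 0 v L ⊆ {x | x ∈ Γ ∧ p x < 1} ∧
        {x | x ∈ Γ ∧ p x < 1} ⊆ (D₂ : K)⁻¹ • gap e 0 v (fun j => D₁ * L j) := by
  let Q := denomBound n d c
  let C : ℝ := Q.factorial ^ n * (2 * Q * (1 + 2 * Q * c) ^ n)
  obtain ⟨D₁, hD₁⟩ := exists_nat_gt (C * (n * c + 1))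
  have hD₁_pos : 0 < D₁ := Nat.cast_pos.1 ((by positivity : 0 ≤ C * (n * c + 1)).trans_lt hD₁)
  refine ⟨D₁, Q.factorial ^ n, hD₁_pos, by positivity, fun p Γ hp hspan hfin => ?_⟩
  obtain ⟨b, hb⟩ := exists_isSuccessiveMinima hn hspan hfin
  have hpos : ∀ j, 0 < p (b j) := fun j =>
    seminorm_pos_of_finite (S := Γ.toAddSubmonoid) (hfin 0) (hb.mem j) (b.ne_zero j)
  -- Rounding up is harmless, since elements of `B(L j)` have norm at most `L j - 1`.
  let L : Fin n → ℕ := fun j => ⌈1 / (n * c + 1) / p (b j)⌉₊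
  have hL : ∀ j, 0 < L j := fun j => Nat.ceil_pos.2 (div_pos (by positivity) (hpos j))
  have hL_lower : ∀ j, 1 / (n * c + 1) ≤ L j * p (b j) := fun j =>
    (div_le_iff₀ (hpos j)).1 (Nat.le_ceil _)
  have hL_upper : ∀ j, (L j - 1) * p (b j) ≤ 1 / (n * c + 1) := fun j => by
    rw [← le_div_iff₀ (hpos j), sub_le_iff_le_add]
    exact (Nat.ceil_lt_add_one (div_pos (by positivity) (hpos j)).le).le
  refine ⟨b, L, hL, fun x hx => ⟨?_, hp.lt_one_of_mem_gap hL hL_upper hx⟩, fun x hx => ?_⟩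
  · obtain ⟨l, -, rfl⟩ := hx
    simpa only [zero_add] using hb.sum_smul_mem l
  · refine hb.mem_inv_smul_gap hp hpos (fun j => mul_pos hD₁_pos (hL j)) (fun j => ?_)
      hx.1 hx.2.le
    calc C = C * (n * c + 1) * (1 / (n * c + 1)) := by field_simp
      _ < D₁ * (1 / (n * c + 1)) := by gcongr
      _ ≤ D₁ * (L j * p (b j)) := by
        gcongr
        exact hL_lower j
      _ = (D₁ * L j : ℕ) * p (b j) := by rw [Nat.cast_mul, mul_assoc]

end Gap

section Gauge

theorem gauge_map_le {E F : Type*} [AddCommGroup E] [Module ℝ E] [AddCommGroup F] [Module ℝ F]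
    (f : E →ₗ[ℝ] F) {s : Set E} {t : Set F} {r : ℝ} (hr : 0 ≤ r) (hs : Absorbent ℝ s)
    (hf : MapsTo f s (r • t)) (x : E) : gauge t (f x) ≤ r * gauge s x := by
  refine le_mul_of_forall_lt₀ fun r' (hr' : r < r') a ha => ?_
  obtain ⟨b, hb, hba, y, hy, rfl⟩ := exists_lt_of_gauge_lt hs ha
  obtain ⟨z, hz, hzy⟩ := hf hy
  have hmem : f (b • y) ∈ (r * b) • t := ⟨z, hz, by
    simp only [map_smul, ← hzy, smul_smul, mul_comm]⟩
  calc gauge t (f (b • y)) ≤ r * b := gauge_le_of_mem (by positivity) hmem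
    _ ≤ r' * a := by
      have hr'0 := hr.trans hr'.le
      gcongr

theorem finite_setOf_mem_and_gauge_le {E : Type*} [NormedAddCommGroup E] [NormedSpace ℝ E]
    [ProperSpace E] {A : AddSubgroup E} [DiscreteTopology A] {s : Set E} (hs : Absorbent ℝ s)
    (hbdd : Bornology.IsBounded s) (R : ℝ) : {x | x ∈ A ∧ gauge s x ≤ R}.Finite := by
  obtain ⟨ρ, hρ, hsρ⟩ := hbdd.subset_closedBall_lt 0 0
  have hsub : {x | x ∈ A ∧ gauge s x ≤ R} ⊆ Metric.closedBall 0 (R * ρ) ∩ A :=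
    fun x ⟨hxA, hxR⟩ => ⟨mem_closedBall_zero_iff.2 <| (div_le_iff₀ hρ).1 <|
      (le_gauge_of_subset_closedBall hs hρ.le hsρ).trans hxR, hxA⟩
  exact (Metric.finite_isBounded_inter_isClosed DiscreteTopology.isDiscrete
    Metric.isBounded_closedBall AddSubgroup.isClosed_of_discrete).subset hsub

variable {K : Type*} [Field K] [NumberField K] {d n : ℕ} (e : Basis (Fin d) ℤ (𝓞 K))

/-- The embedding of `K^n` into `K_ℝ^n ≃ ℝ^{nd}`, as a `ℚ`-linear map. -/
noncomputable def realCoords (n : ℕ) : (Fin n → K) →ₗ[ℚ] (Fin n → Fin d → ℝ) where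
  toFun x := coords e n (embed x)
  map_add' x y := by
    rw [← map_add]
    exact congrArg _ (funext fun j => TensorProduct.tmul_add _ _ _)
  map_smul' q x := by
    rw [RingHom.id_apply, ← map_rat_smul (coords e n)]
    exact congrArg _ (funext fun j => TensorProduct.tmul_smul q (1 : ℝ) (x j))

theorem realCoords_injective : Function.Injective (realCoords e n) := fun _ _ hxy =>
  funext fun j => Algebra.TensorProduct.includeRight_injective
    (FaithfulSMul.algebraMap_injective ℚ ℝ) (congrFun ((coords e n).injective hxy) j)

theorem embed_smul (a : K) (x : Fin n → K) :
    embed (a • x) = ((1 : ℝ) ⊗ₜ[ℚ] a : KR K) • embed x := by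
  funext j
  simp only [embed, Pi.smul_apply, smul_eq_mul, Algebra.TensorProduct.tmul_mul_tmul, mul_one]

namespace IsSymmConvexBody

variable {e} {B : Set (Fin n → KR K)} (hB : IsSymmConvexBody e B)
include hB

theorem convex_image : Convex ℝ (coords e n '' B) :=
  hB.convex.linear_image (coords e n).toLinearMap

theorem balanced_image : Balanced ℝ (coords e n '' B) := by
  rw [balanced_iff_neg_mem hB.convex_image]
  rintro _ ⟨x, hx, rfl⟩
  exact ⟨-x, hB.symm x hx, map_neg _ _⟩

theorem absorbent_image : Absorbent ℝ (coords e n '' B) :=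
  absorbent_nhds_zero <| hB.isOpen.mem_nhds <|
    hB.balanced_image.zero_mem (hB.nonempty.image _)

/-- The gauge (Minkowski functional) of a symmetric convex body, restricted to `K^n`. -/
noncomputable def seminorm : Seminorm ℚ (Fin n → K) :=
  ((gaugeSeminorm hB.balanced_image hB.convex_image hB.absorbent_image).restrictScalars ℚ).comp
    (realCoords e n)

theorem seminorm_apply (x : Fin n → K) :
    hB.seminorm x = gauge (coords e n '' B) (coords e n (embed x)) := rfl

theorem seminorm_lt_one_iff {x : Fin n → K} : hB.seminorm x < 1 ↔ embed x ∈ B := by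
  have hunit := setOfPred_gauge_lt_one_eq_self_of_isOpen hB.convex_image
    hB.absorbent_image.zero_mem hB.isOpen
  rw [seminorm_apply, ← (coords e n).injective.mem_set_image]
  exact Set.ext_iff.1 hunit _

theorem isThickSeminorm {r : ℝ} (hr : 0 ≤ r) (hthick : IsThick e r B) :
    IsThickSeminorm e (d * r) hB.seminorm := by
  refine isThickSeminorm_of_basis hr fun i x => ?_
  let a : KR K := 1 ⊗ₜ[ℚ] (e i : K)
  let f := (coords e n).toLinearMap ∘ₗ Algebra.lsmul ℝ ℝ (Fin n → KR K) a ∘ₗ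
    (coords e n).symm.toLinearMap
  have hfa : ∀ y, f (coords e n y) = coords e n (a • y) := fun y => by simp [f]
  have hf : MapsTo f (coords e n '' B) (r • coords e n '' B) := by
    rintro _ ⟨y, hy, rfl⟩
    obtain ⟨z, hz, hzy⟩ := hthick i (smul_mem_smul_set hy)
    exact ⟨coords e n z, mem_image_of_mem _ hz, by rw [hfa, ← hzy, map_smul]⟩
  simpa only [seminorm_apply, embed_smul, hfa, a] using
    gauge_map_le f hr hB.absorbent_image hf (coords e n (embed x))

theorem finite_setOf_mem_and_seminorm_le {Γ : Submodule (𝓞 K) (Fin n → K)}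
    (hΓ : IsOKLattice e Γ) (R : ℝ) : {x | x ∈ Γ ∧ hB.seminorm x ≤ R}.Finite := by
  let A := Γ.toAddSubgroup.map (realCoords e n).toAddMonoidHom
  have : DiscreteTopology A := hΓ
  refine ((finite_setOf_mem_and_gauge_le (A := A) hB.absorbent_image hB.bounded R).preimage
    (realCoords_injective e).injOn).subset ?_
  exact fun x ⟨hxΓ, hxR⟩ => ⟨mem_image_of_mem _ hxΓ, hxR⟩

end IsSymmConvexBody

end Gauge

end OKGeom

theorem lemma4p7 {K : Type*} [Field K] [NumberField K] {d : ℕ}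
    (e : Module.Basis (Fin d) ℤ (𝓞 K)) (n : ℕ) (r : ℝ) (hr : 1 ≤ r) :
    ∃ D₁ D₂ : ℕ, 0 < D₁ ∧ 0 < D₂ ∧
      ∀ (Γ : Submodule (𝓞 K) (Fin n → K)) (B : Set (Fin n → OKGeom.KR K)),
        OKGeom.IsOKLattice e Γ → OKGeom.IsFullRank Γ →
        OKGeom.IsSymmConvexBody e B → OKGeom.IsThick e r B →
        ∃ (v : Fin n → (Fin n → K)) (L : Fin n → ℕ), (∀ j, 0 < L j) ∧
          OKGeom.gap e 0 v L ⊆ OKGeom.embed ⁻¹' B ∩ (Γ : Set (Fin n → K)) ∧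
          OKGeom.embed ⁻¹' B ∩ (Γ : Set (Fin n → K)) ⊆
            (D₂ : K)⁻¹ • OKGeom.gap e 0 v (fun j => D₁ * L j) := by
  have hr0 : 0 ≤ r := zero_le_one.trans hr
  obtain ⟨D₁, D₂, hD₁, hD₂, hgap⟩ :=
    OKGeom.exists_gap_subset_unitBall_subset_smul_gap e (Fin n → K) (c := d * r)
      (Module.finrank_fin_fun K) (by positivity)
  refine ⟨D₁, D₂, hD₁, hD₂, fun Γ B hΓ hrank hB hthick => ?_⟩
  have hunitBall : OKGeom.embed ⁻¹' B ∩ (Γ : Set (Fin n → K)) =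
      {x | x ∈ Γ ∧ hB.seminorm x < 1} := by
    ext x
    exact and_comm.trans (and_congr_right' hB.seminorm_lt_one_iff.symm)
  rw [hunitBall]
  exact hgap hB.seminorm Γ (hB.isThickSeminorm hr0 hthick) hrank
    (hB.finite_setOf_mem_and_seminorm_le hΓ)
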